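/- Let $r,s\ge 3$ be odd integers and let $\ell\ge 1$ be an even integer. Let $D_{r,s,\ell}$ be the dumbbell graph obtained from two vertex-disjoint cycles $C_r$ and $C_s$ by choosing one vertex on each and joining these two vertices by a path of length $\ell$. A complex unit gain graph $\Phi$ on $D_{r,s,\ell}$ is a function $\varphi$ that assigns to each oriented edge $(u,v)$ a complex number of modulus $1$ with $\varphi(v,u)=\varphi(u,v)^{-1}$; its energy $E(\Phi)$ is the sum of the absolute values of the eigenvalues, counted with multiplicity, of the Hermitian matrix $A(\Phi)$ with entries $A(\Phi)_{uv}=\varphi(u,v)$ if $u\sim v$ and $A(\Phi)_{uv}=0$ otherwise. Let $\gamma_r,\gamma_s$ be the products of the gains along the oriented cycles $C_r$ and $C_s$ (the real parts do not depend on the orientations), and put $$\alpha=(-1)^{(r+1)/2}\operatorname{Re}\gamma_r,\qquad \beta=(-1)^{(s+1)/2}\operatorname{Re}\gamma_s .$$ Then the minimum of $E(\Phi)$ over all complex unit gain graphs $\Phi$ on $D_{r,s,\ell}$ is attained, and it is attained exactly at those $\Phi$ for which $(\alpha,\beta)=(0,0)$, that is, for which both cycle gains $\gamma_r,\gamma_s$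 are purely imaginary. -/

import Mathlib

/-- A complex unit gain graph on the simple graph `G`: every oriented edge carries a complex
number of modulus one, and reversing the orientation inverts it. -/
structure UnitGainGraph {V : Type*} (G : SimpleGraph V) where
  gain : G.Dart → Circle
  gain_symm : ∀ d : G.Dart, gain d.symm = (gain d)⁻¹

namespace UnitGainGraph

open Classical in
/-- The Hermitian adjacency matrix: the entry `(u, v)` is the gain of the oriented edge from `u`
to `v`, and `0` if `u` and `v` are not adjacent. -/
noncomputable def adjMatrix {V : Type*} {G : SimpleGraph V} (Φ : UnitGainGraph G) :
    Matrix V V ℂ :=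
  Matrix.of fun u v => if h : G.Adj u v then ((Φ.gain ⟨(u, v), h⟩ : Circle) : ℂ) else 0

theorem adjMatrix_isHermitian {V : Type*} {G : SimpleGraph V} (Φ : UnitGainGraph G) :
    Φ.adjMatrix.IsHermitian := by
  ext u v
  simp only [Matrix.conjTranspose_apply, adjMatrix, Matrix.of_apply]
  by_cases h : G.Adj u v
  · have h2 : G.Adj v u := h.symm
    have h3 : Φ.gain ⟨(v, u), h2⟩ = (Φ.gain ⟨(u, v), h⟩)⁻¹ := Φ.gain_symm ⟨(u, v), h⟩
    rw [dif_pos h, dif_pos h2, h3, Circle.coe_inv_eq_conj]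
    simp
  · have h2 : ¬ G.Adj v u := fun h2 => h h2.symm
    rw [dif_neg h, dif_neg h2]
    simp

/-- The energy: the sum of the absolute values of the eigenvalues (with multiplicity) of the
Hermitian adjacency matrix. -/
noncomputable def energy {V : Type*} [Fintype V] [DecidableEq V] {G : SimpleGraph V}
    (Φ : UnitGainGraph G) : ℝ :=
  ∑ j, |Φ.adjMatrix_isHermitian.eigenvalues j|

end UnitGainGraph

/-- The vertices of the dumbbell graph: those of the cycle `C_r`, the `ℓ - 1` inner vertices of
the joining path, and those of the cycle `C_s`. -/
abbrev DumbbellVertex (r s ℓ : ℕ) : Type := Fin r ⊕ Fin (ℓ - 1) ⊕ Fin s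

/-- Adjacency in the dumbbell graph: the two cycles, the path on the inner vertices, and the
edges joining the ends of that path to vertex `0` of either cycle. If `ℓ = 1` there is no inner
vertex, and the two vertices `0` are joined directly. -/
def dumbbellAdj (r s ℓ : ℕ) : DumbbellVertex r s ℓ → DumbbellVertex r s ℓ → Prop
  | .inl i, .inl j => (SimpleGraph.cycleGraph r).Adj i j
  | .inr (.inl i), .inr (.inl j) => (SimpleGraph.pathGraph (ℓ - 1)).Adj i j
  | .inr (.inr i), .inr (.inr j) => (SimpleGraph.cycleGraph s).Adj i j
  | .inl i, .inr (.inl k) => i.val = 0 ∧ k.val = 0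
  | .inr (.inl k), .inl i => i.val = 0 ∧ k.val = 0
  | .inr (.inl k), .inr (.inr j) => k.val + 1 = ℓ - 1 ∧ j.val = 0
  | .inr (.inr j), .inr (.inl k) => k.val + 1 = ℓ - 1 ∧ j.val = 0
  | .inl i, .inr (.inr j) => ℓ = 1 ∧ i.val = 0 ∧ j.val = 0
  | .inr (.inr j), .inl i => ℓ = 1 ∧ i.val = 0 ∧ j.val = 0

/-- The dumbbell graph `D_{r,s,ℓ}` (for `r, s ≥ 3` and `ℓ ≥ 1`): two vertex disjoint cycles of
lengths `r` and `s`, a vertex of the one joined to a vertex of the other by a path of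
length `ℓ`. -/
def dumbbellGraph (r s ℓ : ℕ) : SimpleGraph (DumbbellVertex r s ℓ) where
  Adj := dumbbellAdj r s ℓ
  symm := ⟨by
    rintro (i | i | i) (j | j | j) h
    all_goals first
      | exact h
      | exact SimpleGraph.Adj.symm h⟩
  loopless := ⟨by
    rintro (i | i | i) h
    all_goals exact SimpleGraph.irrefl _ h⟩

namespace Dumbbell

/-- The gain of the cycle `C_r`: the product of the gains of the oriented edges
`0 → 1 → ⋯ → r - 1 → 0`. The other orientation gives the complex conjugate. -/
noncomputable def gammaR {r s ℓ : ℕ} (Φ : UnitGainGraph (dumbbellGraph r s ℓ)) : ℂ :=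
  ∏ i : Fin r, Φ.adjMatrix (.inl i) (.inl (finRotate r i))

/-- The gain of the cycle `C_s`: the product of the gains of the oriented edges
`0 → 1 → ⋯ → s - 1 → 0`. -/
noncomputable def gammaS {r s ℓ : ℕ} (Φ : UnitGainGraph (dumbbellGraph r s ℓ)) : ℂ :=
  ∏ j : Fin s, Φ.adjMatrix (.inr (.inr j)) (.inr (.inr (finRotate s j)))

/-- `α = δ_r Re γ_r` with `δ_r = (-1)^((r+1)/2)`, for odd `r`. -/
noncomputable def alpha {r s ℓ : ℕ} (Φ : UnitGainGraph (dumbbellGraph r s ℓ)) : ℝ :=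
  (-1) ^ ((r + 1) / 2) * (gammaR Φ).re

/-- `β = δ_s Re γ_s` with `δ_s = (-1)^((s+1)/2)`, for odd `s`. -/
noncomputable def beta {r s ℓ : ℕ} (Φ : UnitGainGraph (dumbbellGraph r s ℓ)) : ℝ :=
  (-1) ^ ((s + 1) / 2) * (gammaS Φ).re

end Dumbbell

/-! The method of Coulson: if `|det (t + i A)|² = ∏ (λ² + t²)` is larger for one Hermitian matrix
than for another at every `t > 0`, then so is `∑ |λ|`. In `t + i A` opposite entries along an
edge have product `-1`, so the determinant of a path on `n` vertices is the Fibonacci polynomial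
`F_{n+1}(t)`, and the determinants of the two odd cycles are `L_r(t) - 2iα` and `L_s(t) - 2iβ`,
with Lucas polynomials `L_r` and `L_s`. Schur complements glue the cycles to the path and give,
for `ℓ = k + 2`,

`|det (t + i A)|² = (p - 4αβ F_{k+2})² + 4 (αU + βV)²`,

where `p, U, V > 0` depend only on `t`. By Cassini's identity `UV - p F_{k+2} = (-1)^k F_r F_s`,
which is nonnegative for even `ℓ`. If `αβ > 0`, then `(αU + βV)² ≥ 4αβ UV` compensates the loss
in the first square, so the right hand side exceeds `p²` unless `α = β = 0`.
-/

/-- The Fibonacci polynomials, evaluated at `t`. -/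
def fibPoly {R : Type*} [Semiring R] (t : R) : ℕ → R
  | 0 => 0
  | 1 => 1
  | n + 2 => t * fibPoly t (n + 1) + fibPoly t n

/-- The Lucas polynomials, evaluated at `t`. -/
def lucasPoly {R : Type*} [Semiring R] (t : R) : ℕ → R
  | 0 => 2
  | 1 => t
  | n + 2 => t * lucasPoly t (n + 1) + lucasPoly t n

section FibonacciLucas

theorem fibPoly_add_two {R : Type*} [Semiring R] (t : R) (n : ℕ) :
    fibPoly t (n + 2) = t * fibPoly t (n + 1) + fibPoly t n := rfl

theorem lucasPoly_add_two {R : Type*} [Semiring R] (t : R) (n : ℕ) :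
    lucasPoly t (n + 2) = t * lucasPoly t (n + 1) + lucasPoly t n := rfl

theorem lucasPoly_succ {R : Type*} [CommSemiring R] (t : R) (n : ℕ) :
    lucasPoly t (n + 1) = t * fibPoly t (n + 1) + 2 * fibPoly t n := by
  induction n using Nat.twoStepInduction with
  | zero => simp [lucasPoly, fibPoly]
  | one => simp [lucasPoly, fibPoly]
  | more n ih₀ ih₁ =>
    rw [lucasPoly_add_two, ih₀, ih₁, fibPoly_add_two t (n + 1), fibPoly_add_two t n]
    ring

theorem map_fibPoly {R S : Type*} [Semiring R] [Semiring S] (f : R →+* S) (t : R) (n : ℕ) :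
    f (fibPoly t n) = fibPoly (f t) n := by
  induction n using Nat.twoStepInduction with
  | zero => simp [fibPoly]
  | one => simp [fibPoly]
  | more n ih₀ ih₁ => simp only [fibPoly_add_two, map_add, map_mul, ih₀, ih₁]

theorem map_lucasPoly {R S : Type*} [Semiring R] [Semiring S] (f : R →+* S) (t : R) (n : ℕ) :
    f (lucasPoly t n) = lucasPoly (f t) n := by
  induction n using Nat.twoStepInduction with
  | zero => exact map_ofNat f 2
  | one => rfl
  | more n ih₀ ih₁ => simp only [lucasPoly_add_two, map_add, map_mul, ih₀, ih₁]

theorem fibPoly_cassini {R : Type*} [CommRing R] (t : R) (n : ℕ) :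
    fibPoly t (n + 1) ^ 2 - fibPoly t (n + 2) * fibPoly t n = (-1) ^ n := by
  induction n with
  | zero => simp [fibPoly]
  | succ n ih =>
    rw [pow_succ (-1), ← ih, fibPoly_add_two t (n + 1), fibPoly_add_two t n]
    ring

variable {R : Type*} [Semiring R] [PartialOrder R] [IsStrictOrderedRing R] {t : R}

theorem fibPoly_succ_pos (ht : 0 < t) (n : ℕ) : 0 < fibPoly t (n + 1) := by
  induction n using Nat.twoStepInduction with
  | zero => simp [fibPoly]
  | one => simpa [fibPoly] using ht
  | more n ih₀ ih₁ => exact add_pos (mul_pos ht ih₁) ih₀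

theorem fibPoly_nonneg (ht : 0 < t) : ∀ n, 0 ≤ fibPoly t n
  | 0 => le_rfl
  | n + 1 => (fibPoly_succ_pos ht n).le

theorem lucasPoly_pos (ht : 0 < t) (n : ℕ) : 0 < lucasPoly t n := by
  induction n using Nat.twoStepInduction with
  | zero => exact two_pos
  | one => exact ht
  | more n ih₀ ih₁ => exact add_pos (mul_pos ht ih₁) ih₀

end FibonacciLucas

section Determinants

open Matrix

theorem eq_single_of_apply_eq_zero {R m n : Type*} [Zero R] [DecidableEq m] [DecidableEq n]
    {M : Matrix m n R} (a : m) (b : n) (h : ∀ i j, ¬ (i = a ∧ j = b) → M i j = 0) :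
    M = single a b (M a b) := by
  ext i j
  by_cases hij : i = a ∧ j = b
  · rw [hij.1, hij.2, single_apply_same]
  · rw [h i j hij, single_apply_of_ne]
    exact mt (And.imp Eq.symm Eq.symm) hij

variable {R : Type*} [CommRing R]

theorem det_add_single {n : Type*} [Fintype n] [DecidableEq n] (M : Matrix n n R) (i j : n)
    (c : R) : (M + single i j c).det = M.det + c * M.adjugate j i := by
  have hrow : M + single i j c = M.updateRow i (M i + c • Pi.single j 1) := by
    ext k l
    rcases eq_or_ne k i with rfl | hk
    · simp [single_apply, Pi.single_apply, eq_comm]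
    · simp [hk, hk.symm]
  rw [hrow, det_updateRow_add, det_updateRow_smul, updateRow_eq_self, adjugate_apply]

theorem det_succ_eq_sub_sum_adjugate {n : ℕ} (M : Matrix (Fin (n + 1)) (Fin (n + 1)) R) :
    M.det = M 0 0 * (M.submatrix Fin.succ Fin.succ).det -
      ∑ i, ∑ j, M 0 i.succ * (M.submatrix Fin.succ Fin.succ).adjugate i j * M j.succ 0 := by
  cases n with
  | zero => simp
  | succ n =>
    have hminor (i : Fin (n + 1)) : (-1) ^ (i.succ : ℕ) * M 0 i.succ *
        (M.submatrix Fin.succ i.succ.succAbove).det =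
        -∑ j, M 0 i.succ * (M.submatrix Fin.succ Fin.succ).adjugate i j * M j.succ 0 := by
      rw [det_succ_column_zero, Finset.mul_sum, ← Finset.sum_neg_distrib]
      refine Finset.sum_congr rfl fun j _ => ?_
      have hcols : i.succ.succAbove ∘ Fin.succ = Fin.succ ∘ i.succAbove :=
        funext fun k => Fin.succ_succAbove_succ i k
      rw [adjugate_fin_succ_eq_det_submatrix, submatrix_submatrix, submatrix_submatrix, hcols,
        submatrix_apply, Fin.succ_succAbove_zero, Fin.val_succ]
      ring
    rw [det_succ_row_zero, Fin.sum_univ_succ, Finset.sum_congr rfl fun i _ => hminor i,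
      Finset.sum_neg_distrib, sub_eq_add_neg]
    simp

theorem det_fromBlocks_single₁₁ {m n : Type*} [Fintype m] [DecidableEq m] [Fintype n]
    [DecidableEq n] {A : Matrix m m R} (hA : IsUnit A.det) (D : Matrix n n R) (a : m) (b : n)
    (p q : R) :
    (fromBlocks A (single a b p) (single b a q) D).det =
      A.det * (D - single b b (q * A⁻¹ a a * p)).det := by
  let _ := A.invertibleOfIsUnitDet hA
  rw [det_fromBlocks₁₁, invOf_eq_nonsing_inv, single_mul_mul_single]

theorem det_fromBlocks_single₂₂ {m n : Type*} [Fintype m] [DecidableEq m] [Fintype n]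
    [DecidableEq n] (A : Matrix m m R) {D : Matrix n n R} (hD : IsUnit D.det) (a : m) (b : n)
    (p q : R) :
    (fromBlocks A (single a b p) (single b a q) D).det =
      D.det * (A - single a a (p * D⁻¹ b b * q)).det := by
  let _ := D.invertibleOfIsUnitDet hD
  rw [det_fromBlocks₂₂, invOf_eq_nonsing_inv, single_mul_mul_single]

theorem det_mul_inv_apply {n : Type*} [Fintype n] [DecidableEq n] {A : Matrix n n R}
    (hA : IsUnit A.det) (i j : n) : A.det * A⁻¹ i j = A.adjugate i j := by
  rw [inv_def, Matrix.smul_apply, smul_eq_mul, ← mul_assoc, Ring.mul_inverse_cancel _ hA, one_mul]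

end Determinants

theorem prod_apply_finRotate {R : Type*} [CommMonoid R] {n : ℕ}
    (f : Fin (n + 3) → Fin (n + 3) → R) :
    ∏ i, f i (finRotate (n + 3) i) =
      f 0 1 * (∏ i : Fin (n + 1), f i.succ.castSucc i.succ.succ) * f (Fin.last _) 0 := by
  have hrot (i : Fin (n + 2)) : finRotate (n + 3) i.castSucc = i.succ := by
    rw [finRotate_apply, Fin.coeSucc_eq_succ]
  simp only [Fin.prod_univ_castSucc (n := n + 2), hrot, finRotate_last, Fin.prod_univ_succ,
    Fin.castSucc_zero, Fin.succ_zero_eq_one]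

section SkewGain

open Matrix SimpleGraph

/-- The matrices `t + B` in which `B` is supported on the oriented edges of `G` and opposite
entries of `B` have product `-1`. For a unit gain graph with adjacency matrix `A` the matrix
`t + i A` is of this kind. -/
structure IsSkewGainMatrix {V R : Type*} [CommRing R] (G : SimpleGraph V) (t : R)
    (M : Matrix V V R) : Prop where
  apply_self : ∀ v, M v v = t
  mul_swap : ∀ {u v}, G.Adj u v → M u v * M v u = -1
  apply_eq_zero : ∀ {u v}, u ≠ v → ¬ G.Adj u v → M u v = 0

/-- The inclusion of a path into the path with one more vertex at its beginning. -/
def pathGraphSuccEmbedding (n : ℕ) : pathGraph n ↪g pathGraph (n + 1) where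
  toEmbedding := Fin.succEmb n
  map_rel_iff' := by simp [pathGraph_adj]

@[simp]
theorem coe_pathGraphSuccEmbedding (n : ℕ) : ⇑(pathGraphSuccEmbedding n) = Fin.succ := rfl

/-- The inclusion of a path into the path with one more vertex at its end. -/
def pathGraphCastSuccEmbedding (n : ℕ) : pathGraph n ↪g pathGraph (n + 1) where
  toEmbedding := Fin.castSuccEmb
  map_rel_iff' := by simp [pathGraph_adj]

@[simp]
theorem coe_pathGraphCastSuccEmbedding (n : ℕ) :
    ⇑(pathGraphCastSuccEmbedding n) = Fin.castSucc := rfl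

theorem cycleGraph_adj_iff_val {n : ℕ} {i j : Fin n} (h : i < j) :
    (cycleGraph n).Adj i j ↔ i.val + 1 = j.val ∨ i.val = 0 ∧ j.val + 1 = n := by
  rw [cycleGraph_adj', Fin.sub_val_of_le h.le, Fin.coe_sub_iff_lt.2 h]
  omega

theorem cycleGraph_adj_succ_succ {n : ℕ} {i j : Fin n} :
    (cycleGraph (n + 1)).Adj i.succ j.succ ↔ (pathGraph n).Adj i j := by
  rw [pathGraph_adj]
  rcases lt_trichotomy i j with h | rfl | h
  · rw [cycleGraph_adj_iff_val (Fin.succ_lt_succ_iff.2 h), Fin.val_succ, Fin.val_succ]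
    omega
  · simp
  · rw [adj_comm, cycleGraph_adj_iff_val (Fin.succ_lt_succ_iff.2 h), Fin.val_succ, Fin.val_succ]
    omega

theorem cycleGraph_adj_zero_succ {n : ℕ} {i : Fin (n + 1)} :
    (cycleGraph (n + 2)).Adj 0 i.succ ↔ i = 0 ∨ i = Fin.last n := by
  rw [cycleGraph_adj_iff_val (Fin.succ_pos i), Fin.ext_iff, Fin.ext_iff, Fin.val_succ]
  simp only [Fin.val_zero, Fin.val_last, true_and]
  omega

theorem cycleGraph_adj_finRotate {n : ℕ} (hn : 2 ≤ n) (i : Fin n) :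
    (cycleGraph n).Adj i (finRotate n i) := by
  obtain ⟨m, rfl⟩ := Nat.exists_eq_add_of_le' hn
  exact cycleGraph_adj.2 (Or.inr (by rw [finRotate_apply, add_sub_cancel_left]))

/-- The path that remains when the vertex `0` is removed from a cycle. -/
def pathGraphCycleGraphEmbedding (n : ℕ) : pathGraph n ↪g cycleGraph (n + 1) where
  toEmbedding := Fin.succEmb n
  map_rel_iff' := cycleGraph_adj_succ_succ

@[simp]
theorem coe_pathGraphCycleGraphEmbedding (n : ℕ) :
    ⇑(pathGraphCycleGraphEmbedding n) = Fin.succ := rfl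

namespace Dumbbell

/-- The cycle `C_r` as an induced subgraph of the dumbbell graph. -/
def leftCycleEmbedding (r s ℓ : ℕ) : cycleGraph r ↪g dumbbellGraph r s ℓ where
  toEmbedding := .inl
  map_rel_iff' := Iff.rfl

/-- The inner vertices of the joining path as an induced subgraph of the dumbbell graph. -/
def pathEmbedding (r s ℓ : ℕ) : pathGraph (ℓ - 1) ↪g dumbbellGraph r s ℓ where
  toEmbedding := .trans .inl .inr
  map_rel_iff' := Iff.rfl

/-- The cycle `C_s` as an induced subgraph of the dumbbell graph. -/
def rightCycleEmbedding (r s ℓ : ℕ) : cycleGraph s ↪g dumbbellGraph r s ℓ where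
  toEmbedding := .trans .inr .inr
  map_rel_iff' := Iff.rfl

end Dumbbell

namespace IsSkewGainMatrix

variable {V W R : Type*} [CommRing R] {G : SimpleGraph V} {H : SimpleGraph W} {t : R}

theorem submatrix {M : Matrix V V R} (hM : IsSkewGainMatrix G t M) (f : H ↪g G) :
    IsSkewGainMatrix H t (M.submatrix f f) where
  apply_self v := hM.apply_self (f v)
  mul_swap h := hM.mul_swap (f.map_adj_iff.2 h)
  apply_eq_zero huv h := hM.apply_eq_zero (f.injective.ne huv) (mt f.map_adj_iff.1 h)

theorem transpose {M : Matrix V V R} (hM : IsSkewGainMatrix G t M) : IsSkewGainMatrix G t Mᵀ where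
  apply_self := hM.apply_self
  mul_swap h := hM.mul_swap h.symm
  apply_eq_zero huv h := hM.apply_eq_zero huv.symm (mt Adj.symm h)

theorem det_pathGraph {n : ℕ} {M : Matrix (Fin n) (Fin n) R}
    (hM : IsSkewGainMatrix (pathGraph n) t M) : M.det = fibPoly t (n + 1) := by
  induction n using Nat.twoStepInduction with
  | zero => simp [fibPoly]
  | one => simp [fibPoly, hM.apply_self]
  | more n ih₀ ih₁ =>
    have hN := hM.submatrix (pathGraphSuccEmbedding (n + 1))
    have hadj : (M.submatrix Fin.succ Fin.succ).adjugate 0 0 = fibPoly t (n + 1) := by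
      rw [adjugate_fin_succ_eq_det_submatrix]
      simpa using ih₀ (hN.submatrix (pathGraphSuccEmbedding n))
    have hzero (i : Fin (n + 1)) (hi : i ≠ 0) : M 0 i.succ = 0 :=
      hM.apply_eq_zero (Fin.succ_ne_zero i).symm (by simpa [pathGraph_adj] using hi)
    have hsum : ∑ i, ∑ j, M 0 i.succ * (M.submatrix Fin.succ Fin.succ).adjugate i j * M j.succ 0 =
        -fibPoly t (n + 1) := by
      rw [Fintype.sum_eq_single 0 fun i hi => by simp [hzero i hi],
        Fintype.sum_eq_single 0 fun j hj => by
          rw [hM.apply_eq_zero (Fin.succ_ne_zero j) (by simpa [pathGraph_adj] using hj), mul_zero],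
        hadj]
      linear_combination fibPoly t (n + 1) * hM.mul_swap (u := 0) (v := Fin.succ 0)
        (by simp [pathGraph_adj])
    rw [det_succ_eq_sub_sum_adjugate, hM.apply_self, hsum, fibPoly_add_two, sub_neg_eq_add]
    congr 2
    exact ih₁ hN

section Path

variable {n : ℕ} {M : Matrix (Fin (n + 1)) (Fin (n + 1)) R}
  (hM : IsSkewGainMatrix (pathGraph (n + 1)) t M)
include hM

theorem adjugate_pathGraph_zero_zero : M.adjugate 0 0 = fibPoly t (n + 1) := by
  rw [adjugate_fin_succ_eq_det_submatrix]
  simpa using (hM.submatrix (pathGraphSuccEmbedding n)).det_pathGraph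

theorem adjugate_pathGraph_last_last :
    M.adjugate (Fin.last n) (Fin.last n) = fibPoly t (n + 1) := by
  rw [adjugate_fin_succ_eq_det_submatrix]
  simpa using (hM.submatrix (pathGraphCastSuccEmbedding n)).det_pathGraph

theorem adjugate_pathGraph_zero_last :
    M.adjugate 0 (Fin.last n) = (-1) ^ n * ∏ i : Fin n, M i.castSucc i.succ := by
  have htri : (M.submatrix Fin.castSucc Fin.succ).IsLowerTriangular := fun i j (hij : i < j) =>
    hM.apply_eq_zero (by rw [Ne, Fin.ext_iff]; simp; omega) (by rw [pathGraph_adj]; simp; omega)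
  rw [adjugate_fin_succ_eq_det_submatrix]
  simp [det_of_isLowerTriangular _ htri]

theorem adjugate_pathGraph_last_zero :
    M.adjugate (Fin.last n) 0 = (-1) ^ n * ∏ i : Fin n, M i.succ i.castSucc := by
  rw [← transpose_apply M.adjugate, adjugate_transpose, hM.transpose.adjugate_pathGraph_zero_last]
  rfl

theorem det_pathGraph_add_single_last (y : R) :
    (M + single (Fin.last n) (Fin.last n) y).det = fibPoly t (n + 2) + y * fibPoly t (n + 1) := by
  rw [det_add_single, hM.det_pathGraph, hM.adjugate_pathGraph_last_last]

end Path

theorem det_pathGraph_add_single_last_add_single_zero {n : ℕ}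
    {M : Matrix (Fin (n + 1)) (Fin (n + 1)) R} (hM : IsSkewGainMatrix (pathGraph (n + 1)) t M)
    (x y : R) :
    (M + single (Fin.last n) (Fin.last n) y + single 0 0 x).det =
      fibPoly t (n + 2) + (x + y) * fibPoly t (n + 1) + x * y * fibPoly t n := by
  have hadj : (M + single (Fin.last n) (Fin.last n) y).adjugate 0 0 =
      fibPoly t (n + 1) + y * fibPoly t n := by
    cases n with
    | zero => simp [fibPoly]
    | succ n =>
      rw [← (hM.submatrix (pathGraphSuccEmbedding (n + 1))).det_pathGraph_add_single_last,
        adjugate_fin_succ_eq_det_submatrix, Fin.val_zero, add_zero, pow_zero, one_mul,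
        Fin.succAbove_zero]
      congr 1
      ext i j
      simp [single_apply, ← Fin.succ_last]
  rw [det_add_single, hM.det_pathGraph_add_single_last, hadj]
  ring

theorem adjugate_cycleGraph {n : ℕ} {M : Matrix (Fin (n + 1)) (Fin (n + 1)) R}
    (hM : IsSkewGainMatrix (cycleGraph (n + 1)) t M) : M.adjugate 0 0 = fibPoly t (n + 1) := by
  rw [adjugate_fin_succ_eq_det_submatrix]
  simpa using (hM.submatrix (pathGraphCycleGraphEmbedding n)).det_pathGraph

theorem det_cycleGraph {n : ℕ} {M : Matrix (Fin (n + 3)) (Fin (n + 3)) R}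
    (hM : IsSkewGainMatrix (cycleGraph (n + 3)) t M) :
    M.det = lucasPoly t (n + 3) - (-1) ^ (n + 3) *
      (∏ i, M i (finRotate (n + 3) i) + ∏ i, M (finRotate (n + 3) i) i) := by
  have hP := hM.submatrix (pathGraphCycleGraphEmbedding (n + 2))
  rw [coe_pathGraphCycleGraphEmbedding] at hP
  have hrow (i : Fin (n + 2)) (hi : i ≠ 0 ∧ i ≠ Fin.last (n + 1)) : M 0 i.succ = 0 :=
    hM.apply_eq_zero (Fin.succ_ne_zero i).symm (by rw [cycleGraph_adj_zero_succ]; tauto)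
  have hcol (j : Fin (n + 2)) (hj : j ≠ 0 ∧ j ≠ Fin.last (n + 1)) : M j.succ 0 = 0 :=
    hM.apply_eq_zero (Fin.succ_ne_zero j) (by rw [adj_comm, cycleGraph_adj_zero_succ]; tauto)
  have hfirst : M 0 1 * M 1 0 = -1 := hM.mul_swap (cycleGraph_adj_zero_succ.2 (.inl rfl))
  have hlast : M 0 (Fin.last _) * M (Fin.last _) 0 = -1 :=
    hM.mul_swap (cycleGraph_adj_zero_succ.2 (.inr rfl))
  have hprod := prod_apply_finRotate M
  have hprod' := prod_apply_finRotate fun i j => M j i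
  have h0l : (0 : Fin (n + 2)) ≠ Fin.last (n + 1) := Fin.last_pos'.ne
  rw [det_succ_eq_sub_sum_adjugate, Fintype.sum_eq_add _ _ h0l fun i hi => by simp [hrow i hi],
    Fintype.sum_eq_add _ _ h0l fun j hj => by simp [hcol j hj],
    Fintype.sum_eq_add _ _ h0l fun j hj => by simp [hcol j hj],
    hP.det_pathGraph, hP.adjugate_pathGraph_zero_zero, hP.adjugate_pathGraph_last_last,
    hP.adjugate_pathGraph_zero_last, hP.adjugate_pathGraph_last_zero, hM.apply_self, hprod, hprod',
    lucasPoly_succ]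
  simp only [submatrix_apply, Fin.succ_zero_eq_one, Fin.succ_last, Fin.succ_castSucc]
  linear_combination (-fibPoly t (n + 2)) * (hfirst + hlast)

theorem det_fromBlocks_pathGraph {m n : Type*} [Fintype m] [DecidableEq m] [Fintype n]
    [DecidableEq n] {k : ℕ} {A : Matrix m m R} {P : Matrix (Fin (k + 1)) (Fin (k + 1)) R}
    {D : Matrix n n R} (hP : IsSkewGainMatrix (pathGraph (k + 1)) t P) (hA : IsUnit A.det)
    (hD : IsUnit D.det) (a : m) (b : n) {p p' q q' : R} (hp : p * p' = -1) (hq : q * q' = -1) :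
    (fromBlocks A (single a (.inl 0) p) (single (.inl 0) a p')
        (fromBlocks P (single (Fin.last k) b q) (single b (Fin.last k) q') D)).det =
      A.det * D.det * fibPoly t (k + 2) +
        (A.adjugate a a * D.det + A.det * D.adjugate b b) * fibPoly t (k + 1) +
        A.adjugate a a * D.adjugate b b * fibPoly t k := by
  have hleft : fromBlocks P (single (Fin.last k) b q) (single b (Fin.last k) q') D -
      single (.inl 0) (.inl 0) (p' * A⁻¹ a a * p) =
      fromBlocks (P + single 0 0 (A⁻¹ a a)) (single (Fin.last k) b q)
        (single b (Fin.last k) q') D := by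
    have hcoef : p' * A⁻¹ a a * p = -A⁻¹ a a := by linear_combination A⁻¹ a a * hp
    rw [hcoef, ← single_neg, sub_neg_eq_add]
    ext (i | i) (j | j) <;> simp [single_apply]
  have hright : P + single 0 0 (A⁻¹ a a) - single (Fin.last k) (Fin.last k) (q * D⁻¹ b b * q') =
      P + single (Fin.last k) (Fin.last k) (D⁻¹ b b) + single 0 0 (A⁻¹ a a) := by
    have hcoef : q * D⁻¹ b b * q' = -D⁻¹ b b := by linear_combination D⁻¹ b b * hq
    rw [hcoef, ← single_neg, sub_neg_eq_add, add_right_comm]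
  rw [det_fromBlocks_single₁₁ hA, hleft, det_fromBlocks_single₂₂ _ hD, hright,
    hP.det_pathGraph_add_single_last_add_single_zero, ← det_mul_inv_apply hA,
    ← det_mul_inv_apply hD]
  ring

theorem det_dumbbellGraph {r s k : ℕ} [NeZero r] [NeZero s]
    {M : Matrix (Fin r ⊕ Fin (k + 1) ⊕ Fin s) (Fin r ⊕ Fin (k + 1) ⊕ Fin s) R}
    (hM : IsSkewGainMatrix (dumbbellGraph r s (k + 2)) t M) (hr : IsUnit M.toBlocks₁₁.det)
    (hs : IsUnit M.toBlocks₂₂.toBlocks₂₂.det) :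
    M.det = M.toBlocks₁₁.det * M.toBlocks₂₂.toBlocks₂₂.det * fibPoly t (k + 2) +
      (M.toBlocks₁₁.adjugate 0 0 * M.toBlocks₂₂.toBlocks₂₂.det +
        M.toBlocks₁₁.det * M.toBlocks₂₂.toBlocks₂₂.adjugate 0 0) * fibPoly t (k + 1) +
      M.toBlocks₁₁.adjugate 0 0 * M.toBlocks₂₂.toBlocks₂₂.adjugate 0 0 * fibPoly t k := by
  have hadj_left : (dumbbellGraph r s (k + 2)).Adj (.inl 0) (.inr (.inl (0 : Fin (k + 1)))) :=
    show _ ∧ _ from ⟨rfl, rfl⟩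
  have hadj_right :
      (dumbbellGraph r s (k + 2)).Adj (.inr (.inl (Fin.last k))) (.inr (.inr 0)) :=
    show _ ∧ _ from ⟨rfl, rfl⟩
  have hleft (i : Fin r) (v : Fin (k + 1) ⊕ Fin s) (hv : ¬ (i = 0 ∧ v = .inl 0)) :
      ¬ (dumbbellGraph r s (k + 2)).Adj (.inl i) (.inr v) := by
    rcases v with j | j
    · exact fun h : _ ∧ _ => hv ⟨Fin.ext h.1, congrArg _ (Fin.ext h.2)⟩
    · exact fun h : _ ∧ _ => absurd h.1 (by omega)
  have hright (i : Fin (k + 1)) (j : Fin s) (hij : ¬ (i = Fin.last k ∧ j = 0)) :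
      ¬ (dumbbellGraph r s (k + 2)).Adj (.inr (.inl i)) (.inr (.inr j)) :=
    fun h : _ ∧ _ => hij ⟨Fin.ext (Nat.succ_injective h.1), Fin.ext h.2⟩
  have h₁₂ := eq_single_of_apply_eq_zero (M := M.toBlocks₁₂) 0 (.inl 0) fun i v hv =>
    hM.apply_eq_zero Sum.inl_ne_inr (hleft i v hv)
  have h₂₁ := eq_single_of_apply_eq_zero (M := M.toBlocks₂₁) (.inl 0) 0 fun v i hv =>
    hM.apply_eq_zero Sum.inr_ne_inl fun h => hleft i v (mt And.symm hv) h.symm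
  have h₂₃ := eq_single_of_apply_eq_zero (M := M.toBlocks₂₂.toBlocks₁₂) (Fin.last k) 0
    fun i j hij => hM.apply_eq_zero (by simp) (hright i j hij)
  have h₃₂ := eq_single_of_apply_eq_zero (M := M.toBlocks₂₂.toBlocks₂₁) 0 (Fin.last k)
    fun j i hij => hM.apply_eq_zero (by simp) fun h => hright i j (mt And.symm hij) h.symm
  have hP : IsSkewGainMatrix (pathGraph (k + 1)) t M.toBlocks₂₂.toBlocks₁₁ :=
    hM.submatrix (Dumbbell.pathEmbedding r s (k + 2))
  rw [← hP.det_fromBlocks_pathGraph hr hs 0 0 (hM.mul_swap hadj_left) (hM.mul_swap hadj_right)]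
  conv_lhs => rw [← fromBlocks_toBlocks M, h₁₂, h₂₁, ← fromBlocks_toBlocks M.toBlocks₂₂, h₂₃, h₃₂]
  rfl

end IsSkewGainMatrix

end SkewGain

section LogPrimitive

open Filter Topology Real

/-- An antiderivative of `t ↦ log (a ^ 2 + t ^ 2) + 2`, used to compare sums `∑ |a|` in the manner
of Coulson's integral formula. At `a = 0` the division by zero in `t / a` is harmless because of
the factor `a`. -/
noncomputable def logPrimitive (a t : ℝ) : ℝ :=
  t * log (a ^ 2 + t ^ 2) + 2 * (a * arctan (t / a))

theorem hasDerivAt_logPrimitive (a : ℝ) {t : ℝ} (ht : 0 < t) :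
    HasDerivAt (logPrimitive a) (log (a ^ 2 + t ^ 2) + 2) t := by
  have hpos : 0 < a ^ 2 + t ^ 2 := by positivity
  have hsq : HasDerivAt (fun t : ℝ => a ^ 2 + t ^ 2) (2 * t) t := by
    simpa using (hasDerivAt_pow 2 t).const_add (a ^ 2)
  have hlog := (hasDerivAt_id t).mul (hsq.log hpos.ne')
  have harctan := (((hasDerivAt_id t).div_const a).arctan.const_mul a).const_mul 2
  refine (hlog.add harctan).congr_deriv ?_
  rw [id_eq]
  rcases eq_or_ne a 0 with rfl | ha <;> field_simp <;> ring

theorem continuous_logPrimitive (a : ℝ) : Continuous (logPrimitive a) := by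
  refine Continuous.add ?_ (by fun_prop)
  rcases eq_or_ne a 0 with rfl | ha
  · have hlog (t : ℝ) : 2 * (t * log t) = t * log (0 ^ 2 + t ^ 2) := by
      rw [zero_pow two_ne_zero, zero_add, log_pow, Nat.cast_ofNat, mul_left_comm]
    exact (continuous_mul_log.const_mul 2).congr hlog
  · exact continuous_id.mul (Continuous.log (by fun_prop) fun t => by positivity)

theorem logPrimitive_zero (a : ℝ) : logPrimitive a 0 = 0 := by
  simp [logPrimitive]

theorem tendsto_mul_log_one_add_sq_div_sq (a : ℝ) :
    Tendsto (fun t : ℝ => t * log (1 + a ^ 2 / t ^ 2)) atTop (𝓝 0) := by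
  have hupper : Tendsto (fun t : ℝ => a ^ 2 / t) atTop (𝓝 0) :=
    tendsto_const_nhds.div_atTop tendsto_id
  refine tendsto_of_tendsto_of_tendsto_of_le_of_le' tendsto_const_nhds hupper ?_ ?_
  · filter_upwards [eventually_gt_atTop 0] with t ht
    exact mul_nonneg ht.le (log_nonneg (le_add_of_nonneg_right (by positivity)))
  · filter_upwards [eventually_gt_atTop 0] with t ht
    have hle := log_le_sub_one_of_pos (show 0 < 1 + a ^ 2 / t ^ 2 by positivity)
    calc t * log (1 + a ^ 2 / t ^ 2) ≤ t * (1 + a ^ 2 / t ^ 2 - 1) := by gcongr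
      _ = a ^ 2 / t := by field_simp; ring

theorem tendsto_mul_arctan_div (a : ℝ) :
    Tendsto (fun t : ℝ => a * arctan (t / a)) atTop (𝓝 (π / 2 * |a|)) := by
  rcases lt_trichotomy a 0 with ha | rfl | ha
  · have h := (tendsto_arctan_atBot.mono_right nhdsWithin_le_nhds).comp
      (tendsto_id.atTop_div_const_of_neg ha)
    rw [abs_of_neg ha, mul_neg, ← neg_mul, mul_comm]
    exact h.const_mul a
  · simp
  · have h := (tendsto_arctan_atTop.mono_right nhdsWithin_le_nhds).comp
      (tendsto_id.atTop_div_const ha)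
    rw [abs_of_pos ha, mul_comm]
    exact h.const_mul a

theorem tendsto_logPrimitive_sub (a : ℝ) :
    Tendsto (fun t => logPrimitive a t - 2 * (t * log t)) atTop (𝓝 (π * |a|)) := by
  have hsum := (tendsto_mul_log_one_add_sq_div_sq a).add ((tendsto_mul_arctan_div a).const_mul 2)
  rw [zero_add, ← mul_assoc, mul_div_cancel₀ π two_ne_zero] at hsum
  refine hsum.congr' ?_
  filter_upwards [eventually_gt_atTop 0] with t ht
  have hsplit : a ^ 2 + t ^ 2 = t ^ 2 * (1 + a ^ 2 / t ^ 2) := by field_simp; ring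
  rw [logPrimitive, hsplit, log_mul (by positivity) (by positivity), log_pow, Nat.cast_ofNat]
  ring

section Comparison

variable {ι : Type*} [Fintype ι] (a b : ι → ℝ)

theorem hasDerivAt_sum_logPrimitive_sub {t : ℝ} (ht : 0 < t) :
    HasDerivAt (fun t => ∑ i, (logPrimitive (b i) t - logPrimitive (a i) t))
      (log (∏ i, (b i ^ 2 + t ^ 2)) - log (∏ i, (a i ^ 2 + t ^ 2))) t := by
  rw [log_prod (fun i _ => by positivity), log_prod (fun i _ => by positivity),
    ← Finset.sum_sub_distrib]
  refine HasDerivAt.fun_sum fun i _ => ?_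
  exact ((hasDerivAt_logPrimitive (b i) ht).sub (hasDerivAt_logPrimitive (a i) ht)).congr_deriv
    (by ring)

theorem continuous_sum_logPrimitive_sub :
    Continuous fun t => ∑ i, (logPrimitive (b i) t - logPrimitive (a i) t) :=
  continuous_finsetSum _ fun i _ =>
    (continuous_logPrimitive (b i)).sub (continuous_logPrimitive (a i))

theorem tendsto_sum_logPrimitive_sub :
    Tendsto (fun t => ∑ i, (logPrimitive (b i) t - logPrimitive (a i) t)) atTop
      (𝓝 (π * (∑ i, |b i| - ∑ i, |a i|))) := by
  rw [← Finset.sum_sub_distrib, Finset.mul_sum]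
  refine tendsto_finsetSum _ fun i _ => ?_
  have h := (tendsto_logPrimitive_sub (b i)).sub (tendsto_logPrimitive_sub (a i))
  rw [← mul_sub] at h
  exact h.congr fun t => by ring

variable {a b}

theorem sum_abs_le_of_prod_sq_add_sq_le
    (h : ∀ t : ℝ, 0 < t → ∏ i, (a i ^ 2 + t ^ 2) ≤ ∏ i, (b i ^ 2 + t ^ 2)) :
    ∑ i, |a i| ≤ ∑ i, |b i| := by
  have hmono : MonotoneOn (fun t => ∑ i, (logPrimitive (b i) t - logPrimitive (a i) t))
      (Set.Ici 0) := by
    refine monotoneOn_of_deriv_nonneg (convex_Ici 0)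
      (continuous_sum_logPrimitive_sub a b).continuousOn ?_ ?_ <;> rw [interior_Ici]
    · exact fun t ht =>
        (hasDerivAt_sum_logPrimitive_sub a b ht).differentiableAt.differentiableWithinAt
    · intro t (ht : 0 < t)
      rw [(hasDerivAt_sum_logPrimitive_sub a b ht).deriv]
      exact sub_nonneg.2 (log_le_log (Finset.prod_pos fun i _ => by positivity) (h t ht))
  have hlim := ge_of_tendsto (tendsto_sum_logPrimitive_sub a b)
    ((eventually_ge_atTop 0).mono fun t ht => hmono Set.self_mem_Ici ht ht)
  simp only [logPrimitive_zero, sub_zero, Finset.sum_const_zero] at hlim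
  exact sub_nonneg.1 (nonneg_of_mul_nonneg_right hlim pi_pos)

theorem sum_abs_lt_of_prod_sq_add_sq_lt
    (h : ∀ t : ℝ, 0 < t → ∏ i, (a i ^ 2 + t ^ 2) < ∏ i, (b i ^ 2 + t ^ 2)) :
    ∑ i, |a i| < ∑ i, |b i| := by
  have hmono : StrictMonoOn (fun t => ∑ i, (logPrimitive (b i) t - logPrimitive (a i) t))
      (Set.Ici 0) := by
    refine strictMonoOn_of_deriv_pos (convex_Ici 0)
      (continuous_sum_logPrimitive_sub a b).continuousOn ?_
    rw [interior_Ici]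
    intro t (ht : 0 < t)
    rw [(hasDerivAt_sum_logPrimitive_sub a b ht).deriv]
    exact sub_pos.2 (log_lt_log (Finset.prod_pos fun i _ => by positivity) (h t ht))
  have hone := hmono Set.self_mem_Ici (Set.mem_Ici.2 zero_le_one) zero_lt_one
  have hlim := ge_of_tendsto (tendsto_sum_logPrimitive_sub a b)
    ((eventually_ge_atTop 1).mono fun t ht =>
      hmono.monotoneOn (Set.mem_Ici.2 zero_le_one) (Set.mem_Ici.2 (zero_le_one.trans ht)) ht)
  simp only [logPrimitive_zero, sub_zero, Finset.sum_const_zero] at hone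
  exact sub_pos.1 (pos_of_mul_pos_right (hone.trans_le hlim) pi_pos.le)

end Comparison

end LogPrimitive

section CoulsonMatrix

open Matrix Complex

/-- The matrix `t + i A`. For Hermitian `A`, its determinant has absolute value
`∏ √(λ ^ 2 + t ^ 2)` over the eigenvalues `λ` of `A`, which is the quantity that governs the energy
in Coulson's integral formula. -/
noncomputable def coulsonMatrix {n : Type*} [DecidableEq n] (A : Matrix n n ℂ) (t : ℝ) :
    Matrix n n ℂ :=
  (t : ℂ) • (1 : Matrix n n ℂ) + I • A

theorem coulsonMatrix_apply_self {n : Type*} [DecidableEq n] (A : Matrix n n ℂ) (t : ℝ) (i : n) :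
    coulsonMatrix A t i i = t + I * A i i := by
  simp [coulsonMatrix]

theorem coulsonMatrix_apply_of_ne {n : Type*} [DecidableEq n] (A : Matrix n n ℂ) (t : ℝ) {i j : n}
    (h : i ≠ j) : coulsonMatrix A t i j = I * A i j := by
  simp [coulsonMatrix, h]

theorem normSq_det_coulsonMatrix {n : Type*} [Fintype n] [DecidableEq n] {A : Matrix n n ℂ}
    (hA : A.IsHermitian) (t : ℝ) :
    normSq (coulsonMatrix A t).det = ∏ i, (hA.eigenvalues i ^ 2 + t ^ 2) := by
  have hscalar : coulsonMatrix A t = (-I) • (scalar n (I * t) - A) := by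
    rw [coulsonMatrix, smul_sub, scalar_apply, ← smul_one_eq_diagonal, smul_smul, neg_smul,
      sub_neg_eq_add, ← mul_assoc, neg_mul, I_mul_I, neg_neg, one_mul]
  rw [hscalar, det_smul, ← eval_charpoly, hA.charpoly_eq, Polynomial.eval_prod, map_mul, map_pow,
    map_prod, normSq_neg, normSq_I, one_pow, one_mul]
  refine Finset.prod_congr rfl fun i _ => ?_
  rw [Polynomial.eval_sub, Polynomial.eval_X, Polynomial.eval_C, mul_comm I, sub_eq_neg_add,
    RCLike.ofReal_eq_complex_ofReal, ← ofReal_neg, normSq_add_mul_I, neg_sq]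

end CoulsonMatrix

theorem neg_I_pow_of_odd {n : ℕ} (hn : Odd n) :
    (-Complex.I) ^ n = (-1) ^ ((n + 1) / 2) * Complex.I := by
  obtain ⟨m, rfl⟩ := hn
  rw [show (2 * m + 1 + 1) / 2 = m + 1 by omega, pow_succ, pow_mul, neg_sq, Complex.I_sq]
  ring

namespace UnitGainGraph

open Matrix SimpleGraph Complex

variable {V : Type*} {G : SimpleGraph V} (Φ : UnitGainGraph G)

theorem adjMatrix_eq_zero {u v : V} (h : ¬ G.Adj u v) : Φ.adjMatrix u v = 0 :=
  dif_neg h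

theorem adjMatrix_eq_gain {u v : V} (h : G.Adj u v) : Φ.adjMatrix u v = Φ.gain ⟨(u, v), h⟩ :=
  dif_pos h

theorem adjMatrix_mul_adjMatrix {u v : V} (h : G.Adj u v) :
    Φ.adjMatrix u v * Φ.adjMatrix v u = 1 := by
  have hsymm : Φ.gain ⟨(v, u), h.symm⟩ = (Φ.gain ⟨(u, v), h⟩)⁻¹ := Φ.gain_symm ⟨(u, v), h⟩
  rw [adjMatrix_eq_gain Φ h, adjMatrix_eq_gain Φ h.symm, hsymm, ← Circle.coe_mul, mul_inv_cancel,
    Circle.coe_one]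

theorem isSkewGainMatrix_coulsonMatrix [DecidableEq V] (t : ℝ) :
    IsSkewGainMatrix G (t : ℂ) (coulsonMatrix Φ.adjMatrix t) where
  apply_self v := by
    rw [coulsonMatrix_apply_self, Φ.adjMatrix_eq_zero (G.irrefl), mul_zero, add_zero]
  mul_swap h := by
    rw [coulsonMatrix_apply_of_ne _ t h.ne, coulsonMatrix_apply_of_ne _ t h.ne', mul_mul_mul_comm,
      Φ.adjMatrix_mul_adjMatrix h, I_mul_I, mul_one]
  apply_eq_zero huv h := by
    rw [coulsonMatrix_apply_of_ne _ t huv, Φ.adjMatrix_eq_zero h, mul_zero]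

section Cycle

variable [DecidableEq V] {n : ℕ}

theorem det_coulsonMatrix_submatrix_cycle (hn : 3 ≤ n) (f : cycleGraph n ↪g G) (t : ℝ) :
    ((coulsonMatrix Φ.adjMatrix t).submatrix f f).det =
      (lucasPoly t n : ℝ) -
        2 * (-I) ^ n * (∏ i, Φ.adjMatrix (f i) (f (finRotate n i))).re := by
  have hne (i : Fin n) : f i ≠ f (finRotate n i) :=
    f.injective.ne (cycleGraph_adj_finRotate (by omega) i).ne
  have hprod : ∏ i, (coulsonMatrix Φ.adjMatrix t).submatrix f f i (finRotate n i) =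
      I ^ n * ∏ i, Φ.adjMatrix (f i) (f (finRotate n i)) := by
    simp only [submatrix_apply, coulsonMatrix_apply_of_ne _ _ (hne _), Finset.prod_mul_distrib,
      Finset.prod_const, Finset.card_univ, Fintype.card_fin]
  have hprod' : ∏ i, (coulsonMatrix Φ.adjMatrix t).submatrix f f (finRotate n i) i =
      I ^ n * starRingEnd ℂ (∏ i, Φ.adjMatrix (f i) (f (finRotate n i))) := by
    simp only [submatrix_apply, coulsonMatrix_apply_of_ne _ _ (hne _).symm, map_prod,
      Finset.prod_mul_distrib, Finset.prod_const, Finset.card_univ, Fintype.card_fin,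
      starRingEnd_apply, Φ.adjMatrix_isHermitian.apply]
  obtain ⟨m, rfl⟩ := Nat.exists_eq_add_of_le' hn
  rw [((Φ.isSkewGainMatrix_coulsonMatrix t).submatrix f).det_cycleGraph, hprod, hprod', ← mul_add,
    add_conj, neg_pow I, ← ofRealHom_eq_coe (lucasPoly t _), map_lucasPoly, ofRealHom_eq_coe,
    ofReal_mul, ofReal_ofNat]
  ring

theorem det_coulsonMatrix_submatrix_odd_cycle (hn : 3 ≤ n) (hn_odd : Odd n) (f : cycleGraph n ↪g G)
    (t : ℝ) :
    ((coulsonMatrix Φ.adjMatrix t).submatrix f f).det = (lucasPoly t n : ℝ) -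
      2 * ((-1) ^ ((n + 1) / 2) * (∏ i, Φ.adjMatrix (f i) (f (finRotate n i))).re : ℝ) * I := by
  rw [Φ.det_coulsonMatrix_submatrix_cycle hn, neg_I_pow_of_odd hn_odd]
  push_cast
  ring

theorem adjugate_coulsonMatrix_submatrix_cycle [NeZero n] (f : cycleGraph n ↪g G) (t : ℝ) :
    ((coulsonMatrix Φ.adjMatrix t).submatrix f f).adjugate 0 0 = (fibPoly t n : ℝ) := by
  obtain ⟨m, rfl⟩ := Nat.exists_eq_succ_of_ne_zero (NeZero.ne n)
  rw [← ofRealHom_eq_coe, map_fibPoly]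
  exact ((Φ.isSkewGainMatrix_coulsonMatrix t).submatrix f).adjugate_cycleGraph

end Cycle

theorem exists_forall_re_adjMatrix_eq_zero (G : SimpleGraph V) :
    ∃ Φ : UnitGainGraph G, ∀ u v, (Φ.adjMatrix u v).re = 0 := by
  let _ : LinearOrder V := IsWellOrder.linearOrder WellOrderingRel
  let i : Circle := Circle.exp (Real.pi / 2)
  have hi : (i : ℂ) = I := by simp [i, Circle.coe_exp, exp_pi_div_two_mul_I]
  let Φ : UnitGainGraph G :=
    { gain := fun d => if d.fst < d.snd then i else i⁻¹
      gain_symm := fun d => by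
        rcases d.adj.ne.lt_or_gt with h | h <;> simp [h, h.not_gt] }
  refine ⟨Φ, fun u v => ?_⟩
  by_cases h : G.Adj u v
  · rw [Φ.adjMatrix_eq_gain h]
    rcases h.ne.lt_or_gt with huv | huv <;> simp [Φ, huv, huv.not_gt, hi]
  · rw [Φ.adjMatrix_eq_zero h, zero_re]

end UnitGainGraph

theorem re_prod_eq_zero_of_odd_card {ι : Type*} (s : Finset ι) (hs : Odd s.card) {z : ι → ℂ}
    (hz : ∀ i ∈ s, (z i).re = 0) : (∏ i ∈ s, z i).re = 0 := by
  have hconj : starRingEnd ℂ (∏ i ∈ s, z i) = -∏ i ∈ s, z i := by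
    rw [map_prod, Finset.prod_congr rfl fun i hi => ?_, Finset.prod_neg, hs.neg_one_pow,
      neg_one_mul]
    apply Complex.ext <;> simp [hz i hi]
  have hre := congrArg Complex.re hconj
  rw [Complex.conj_re, Complex.neg_re] at hre
  linarith

theorem sq_lt_sq_sub_add_sq_of_mul_le_mul {p f u v a b : ℝ} (hp : 0 < p) (hf : 0 < f)
    (hu : 0 < u) (hv : 0 < v) (hpf : p * f ≤ u * v) (hab : ¬ (a = 0 ∧ b = 0)) :
    p ^ 2 < (p - 4 * (a * b) * f) ^ 2 + 4 * (a * u + b * v) ^ 2 := by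
  have hpf_pos : 0 < p * f := mul_pos hp hf
  rcases lt_trichotomy (a * b) 0 with hneg | hzero | hpos
  · linarith [mul_neg_of_neg_of_pos hneg hpf_pos, sq_nonneg (a * b * f), sq_nonneg (a * u + b * v)]
  · have hne : a * u + b * v ≠ 0 := by
      rcases mul_eq_zero.1 hzero with rfl | rfl
      · simpa [hv.ne'] using hab
      · simpa [hu.ne'] using hab
    rw [hzero, mul_zero, zero_mul, sub_zero]
    linarith [sq_pos_of_ne_zero hne]
  · have hcross : 4 * (a * b * (p * f)) ≤ (a * u + b * v) ^ 2 := by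
      linarith [mul_le_mul_of_nonneg_left hpf hpos.le, sq_nonneg (a * u - b * v)]
    linarith [mul_pos hpos hpf_pos, sq_nonneg (a * b * f)]

namespace Dumbbell

open Matrix SimpleGraph Complex

/-- The determinant of `t + i A` for a cycle of length `n` with a pendant path on `k + 1` vertices,
when the gain of the cycle is purely imaginary. -/
def tadpoleValue {R : Type*} [Semiring R] (n k : ℕ) (t : R) : R :=
  lucasPoly t n * fibPoly t (k + 2) + fibPoly t n * fibPoly t (k + 1)

/-- The determinant of `t + i A` for the dumbbell graph with a joining path of length `k + 2`, when
both cycle gains are purely imaginary. -/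
def dumbbellValue {R : Type*} [Semiring R] (r s k : ℕ) (t : R) : R :=
  lucasPoly t r * lucasPoly t s * fibPoly t (k + 2) +
    (fibPoly t r * lucasPoly t s + lucasPoly t r * fibPoly t s) * fibPoly t (k + 1) +
    fibPoly t r * fibPoly t s * fibPoly t k

theorem tadpoleValue_mul_tadpoleValue {R : Type*} [CommRing R] (r s k : ℕ) (t : R) :
    tadpoleValue s k t * tadpoleValue r k t =
      dumbbellValue r s k t * fibPoly t (k + 2) + fibPoly t r * fibPoly t s * (-1) ^ k := by
  rw [← fibPoly_cassini t k, tadpoleValue, tadpoleValue, dumbbellValue]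
  ring

section Positivity

variable {R : Type*} [Semiring R] [PartialOrder R] [IsStrictOrderedRing R] {t : R}

theorem tadpoleValue_pos (ht : 0 < t) (n k : ℕ) : 0 < tadpoleValue n k t :=
  add_pos_of_pos_of_nonneg (mul_pos (lucasPoly_pos ht n) (fibPoly_succ_pos ht _))
    (mul_nonneg (fibPoly_nonneg ht n) (fibPoly_nonneg ht _))

theorem dumbbellValue_pos (ht : 0 < t) (r s k : ℕ) : 0 < dumbbellValue r s k t := by
  have hr := lucasPoly_pos ht r
  have hs := lucasPoly_pos ht s
  have hr' := fibPoly_nonneg ht r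
  have hs' := fibPoly_nonneg ht s
  have hk := fibPoly_nonneg ht k
  have hk₁ := fibPoly_succ_pos ht k
  have hk₂ := fibPoly_succ_pos ht (k + 1)
  rw [dumbbellValue]
  positivity

end Positivity

theorem exists_alpha_beta_eq_zero {r s : ℕ} (ℓ : ℕ) (hr : Odd r) (hs : Odd s) :
    ∃ Φ : UnitGainGraph (dumbbellGraph r s ℓ), alpha Φ = 0 ∧ beta Φ = 0 := by
  obtain ⟨Φ, hΦ⟩ := UnitGainGraph.exists_forall_re_adjMatrix_eq_zero (dumbbellGraph r s ℓ)
  refine ⟨Φ, ?_, ?_⟩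
  · rw [alpha, gammaR, re_prod_eq_zero_of_odd_card _ (by simpa) fun i _ => hΦ _ _, mul_zero]
  · rw [beta, gammaS, re_prod_eq_zero_of_odd_card _ (by simpa) fun i _ => hΦ _ _, mul_zero]

section Determinant

variable {r s ℓ k : ℕ} (hr : 3 ≤ r) (hs : 3 ≤ s) (hr_odd : Odd r) (hs_odd : Odd s)

include hr hr_odd in
theorem det_toBlocks₁₁_coulsonMatrix (Φ : UnitGainGraph (dumbbellGraph r s ℓ)) (t : ℝ) :
    (coulsonMatrix Φ.adjMatrix t).toBlocks₁₁.det = (lucasPoly t r : ℝ) - 2 * alpha Φ * I :=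
  Φ.det_coulsonMatrix_submatrix_odd_cycle hr hr_odd (leftCycleEmbedding r s ℓ) t

include hs hs_odd in
theorem det_toBlocks₂₂_toBlocks₂₂_coulsonMatrix (Φ : UnitGainGraph (dumbbellGraph r s ℓ)) (t : ℝ) :
    (coulsonMatrix Φ.adjMatrix t).toBlocks₂₂.toBlocks₂₂.det =
      (lucasPoly t s : ℝ) - 2 * beta Φ * I :=
  Φ.det_coulsonMatrix_submatrix_odd_cycle hs hs_odd (rightCycleEmbedding r s ℓ) t

include hr hs hr_odd hs_odd

theorem det_coulsonMatrix (Φ : UnitGainGraph (dumbbellGraph r s (k + 2))) {t : ℝ} (ht : 0 < t) :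
    (coulsonMatrix Φ.adjMatrix t).det =
      (dumbbellValue r s k t - 4 * (alpha Φ * beta Φ) * fibPoly t (k + 2) : ℝ) -
        (2 * (alpha Φ * tadpoleValue s k t + beta Φ * tadpoleValue r k t) : ℝ) * I := by
  have : NeZero r := ⟨by omega⟩
  have : NeZero s := ⟨by omega⟩
  have hunit {n : ℕ} {a : ℝ} : IsUnit ((lucasPoly t n : ℝ) - 2 * a * I : ℂ) := by
    refine isUnit_iff_ne_zero.2 (ne_of_apply_ne re ?_)
    simpa using (lucasPoly_pos ht n).ne'
  have hdet_left := det_toBlocks₁₁_coulsonMatrix hr hr_odd Φ t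
  have hdet_right := det_toBlocks₂₂_toBlocks₂₂_coulsonMatrix hs hs_odd Φ t
  have hadj_left : (coulsonMatrix Φ.adjMatrix t).toBlocks₁₁.adjugate 0 0 = (fibPoly t r : ℝ) :=
    Φ.adjugate_coulsonMatrix_submatrix_cycle (leftCycleEmbedding r s _) t
  have hadj_right : (coulsonMatrix Φ.adjMatrix t).toBlocks₂₂.toBlocks₂₂.adjugate 0 0 =
      (fibPoly t s : ℝ) :=
    Φ.adjugate_coulsonMatrix_submatrix_cycle (rightCycleEmbedding r s _) t
  have hfib (n : ℕ) : fibPoly (t : ℂ) n = (fibPoly t n : ℝ) := (map_fibPoly ofRealHom t n).symm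
  rw [(Φ.isSkewGainMatrix_coulsonMatrix t).det_dumbbellGraph (hdet_left ▸ hunit)
    (hdet_right ▸ hunit), hdet_left, hdet_right, hadj_left, hadj_right, hfib, hfib, hfib,
    dumbbellValue, tadpoleValue, tadpoleValue]
  push_cast
  linear_combination 4 * alpha Φ * beta Φ * (fibPoly t (k + 2) : ℝ) * I_sq

theorem prod_eigenvalues_sq_add_sq (Φ : UnitGainGraph (dumbbellGraph r s (k + 2))) {t : ℝ}
    (ht : 0 < t) :
    ∏ i, (Φ.adjMatrix_isHermitian.eigenvalues i ^ 2 + t ^ 2) =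
      (dumbbellValue r s k t - 4 * (alpha Φ * beta Φ) * fibPoly t (k + 2)) ^ 2 +
        4 * (alpha Φ * tadpoleValue s k t + beta Φ * tadpoleValue r k t) ^ 2 := by
  rw [← normSq_det_coulsonMatrix, det_coulsonMatrix hr hs hr_odd hs_odd Φ ht, sub_eq_add_neg,
    ← neg_mul, ← ofReal_neg, normSq_add_mul_I]
  ring

theorem prod_eigenvalues_sq_add_sq_of_eq_zero {Φ : UnitGainGraph (dumbbellGraph r s (k + 2))}
    (hΦ : alpha Φ = 0 ∧ beta Φ = 0) {t : ℝ} (ht : 0 < t) :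
    ∏ i, (Φ.adjMatrix_isHermitian.eigenvalues i ^ 2 + t ^ 2) = dumbbellValue r s k t ^ 2 := by
  rw [prod_eigenvalues_sq_add_sq hr hs hr_odd hs_odd Φ ht, hΦ.1, hΦ.2]
  ring

theorem sq_dumbbellValue_lt_prod_eigenvalues_sq_add_sq (hk : Even k)
    {Φ : UnitGainGraph (dumbbellGraph r s (k + 2))} (hΦ : ¬ (alpha Φ = 0 ∧ beta Φ = 0)) {t : ℝ}
    (ht : 0 < t) :
    dumbbellValue r s k t ^ 2 < ∏ i, (Φ.adjMatrix_isHermitian.eigenvalues i ^ 2 + t ^ 2) := by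
  have hcassini : dumbbellValue r s k t * fibPoly t (k + 2) ≤
      tadpoleValue s k t * tadpoleValue r k t := by
    rw [tadpoleValue_mul_tadpoleValue, hk.neg_one_pow, mul_one]
    exact le_add_of_nonneg_right (mul_nonneg (fibPoly_nonneg ht r) (fibPoly_nonneg ht s))
  rw [prod_eigenvalues_sq_add_sq hr hs hr_odd hs_odd Φ ht]
  exact sq_lt_sq_sub_add_sq_of_mul_le_mul (dumbbellValue_pos ht r s k)
    (fibPoly_succ_pos ht (k + 1)) (tadpoleValue_pos ht s k) (tadpoleValue_pos ht r k) hcassini hΦ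

theorem energy_eq_energy {Φ Ψ : UnitGainGraph (dumbbellGraph r s (k + 2))}
    (hΦ : alpha Φ = 0 ∧ beta Φ = 0) (hΨ : alpha Ψ = 0 ∧ beta Ψ = 0) : Φ.energy = Ψ.energy := by
  apply le_antisymm <;> refine sum_abs_le_of_prod_sq_add_sq_le fun t ht => le_of_eq ?_ <;>
    rw [prod_eigenvalues_sq_add_sq_of_eq_zero hr hs hr_odd hs_odd hΦ ht,
      prod_eigenvalues_sq_add_sq_of_eq_zero hr hs hr_odd hs_odd hΨ ht]

theorem energy_lt_energy (hk : Even k) {Φ Ψ : UnitGainGraph (dumbbellGraph r s (k + 2))}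
    (hΦ : alpha Φ = 0 ∧ beta Φ = 0) (hΨ : ¬ (alpha Ψ = 0 ∧ beta Ψ = 0)) : Φ.energy < Ψ.energy :=
  sum_abs_lt_of_prod_sq_add_sq_lt fun t ht => by
    rw [prod_eigenvalues_sq_add_sq_of_eq_zero hr hs hr_odd hs_odd hΦ ht]
    exact sq_dumbbellValue_lt_prod_eigenvalues_sq_add_sq hr hs hr_odd hs_odd hk hΨ ht

theorem energy_le_energy (hk : Even k) {Φ : UnitGainGraph (dumbbellGraph r s (k + 2))}
    (hΦ : alpha Φ = 0 ∧ beta Φ = 0) (Ψ : UnitGainGraph (dumbbellGraph r s (k + 2))) :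
    Φ.energy ≤ Ψ.energy := by
  by_cases hΨ : alpha Ψ = 0 ∧ beta Ψ = 0
  · exact (energy_eq_energy hr hs hr_odd hs_odd hΦ hΨ).le
  · exact (energy_lt_energy hr hs hr_odd hs_odd hk hΦ hΨ).le

end Determinant

end Dumbbell

theorem mainTheorem6 (r s ℓ : ℕ) (hr : 3 ≤ r) (hs : 3 ≤ s) (hℓ : 1 ≤ ℓ)
    (hr_odd : Odd r) (hs_odd : Odd s) (hℓ_even : Even ℓ) :
    (∃ Φ : UnitGainGraph (dumbbellGraph r s ℓ),
      ∀ Ψ : UnitGainGraph (dumbbellGraph r s ℓ), Φ.energy ≤ Ψ.energy) ∧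
    ∀ Φ : UnitGainGraph (dumbbellGraph r s ℓ),
      (∀ Ψ : UnitGainGraph (dumbbellGraph r s ℓ), Φ.energy ≤ Ψ.energy) ↔
        (Dumbbell.alpha Φ, Dumbbell.beta Φ) = (0, 0) := by
  obtain ⟨k, rfl⟩ : ∃ k, ℓ = k + 2 :=
    Nat.exists_eq_add_of_le' (hℓ.lt_of_ne fun h => absurd hℓ_even (h ▸ Nat.not_even_one))
  have hk : Even k := (Nat.even_add.1 hℓ_even).2 even_two
  obtain ⟨Φ₀, hΦ₀⟩ := Dumbbell.exists_alpha_beta_eq_zero (k + 2) hr_odd hs_odd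
  refine ⟨⟨Φ₀, Dumbbell.energy_le_energy hr hs hr_odd hs_odd hk hΦ₀⟩, fun Φ => ?_⟩
  rw [Prod.mk.injEq]
  refine ⟨fun hmin => ?_, fun hΦ => Dumbbell.energy_le_energy hr hs hr_odd hs_odd hk hΦ⟩
  by_contra hΦ
  exact (Dumbbell.energy_lt_energy hr hs hr_odd hs_odd hk hΦ₀ hΦ).not_ge (hmin Φ₀)
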